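/- **Setting.** Let $N\ge 1$ and $K\ge 0$ be integers. An input is a pair $(\mathbf H,\mathbf y)$ with $\mathbf H\in\mathbb R^{N\times K}$, $\mathbf y\in\mathbb R^N$, i.e. a point of $\mathbb R^{N\times(K+1)}$. Let $\mathcal X\subset\mathbb R$ be a finite constellation. A maximum-likelihood (ML) detector is a function $f_{ML}:\mathbb R^{N\times(K+1)}\to\mathbb R^K$ with $$f_{ML}(\mathbf H,\mathbf y)\in\operatorname*{argmin}_{\mathbf x\in\mathcal X^K}\|\mathbf y-\mathbf H\mathbf x\|_2^2\qquad\text{for all }(\mathbf H,\mathbf y)$$ (any choice of minimiser where it is not unique). **ChannelNet-MLP.** Fix a continuous activation $\sigma:\mathbb R\to\mathbb R$ that is not a polynomial function. An MLP is a finite composition of affine maps with coordinatewise application of $\sigma$ between consecutive affine maps. A ChannelNet-MLP has a feature dimension $d$, a number $L\ge 1$ of iterations, and MLPs $\phi^{(1)}:\mathbb R\to\mathbb R^d$, $\phi^{(t)}:\mathbb R^d\to\mathbb R^d$ ($2\le t\le L$), $\psi^{(t)}:\mathbb R^d\to\mathbb R^d$ ($1\le t<L$), $\psi^{(L)}:\mathbb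 R^d\to\mathbb R$. For an input $(\mathbf H,\mathbf y)$, with $\Phi^{(t)},\Psi^{(t)}$ denoting the application of $\phi^{(t)},\psi^{(t)}$ to each row (antenna) separately, put $$\mathbf G^{(1)}=\mathbf H^T\Phi^{(1)}(\mathbf y),\qquad \mathbf G^{(t+1)}=\mathbf H^T\,\Phi^{(t+1)}\!\big(\mathbf H\,\Psi^{(t)}(\mathbf G^{(t)})-\mathbf y\mathbf 1_d^T\big)+\mathbf G^{(t)}\quad(1\le t<L),$$ and the output is $f(\mathbf H,\mathbf y)=\Psi^{(L)}(\mathbf G^{(L)})\in\mathbb R^K$. **Corollary (approximation of the ML detector).** Let $X\subset\mathbb R^{N\times(K+1)}$ be compact and let $P$ be a Borel probability measure on $X$ which is a continuous distribution, in the sense that either $P$ is absolutely continuous with respect to Lebesgue measure on $\mathbb R^{N\times(K+1)}$, or $N=2N_r$, $K=2N_t$ and, up to a relabelling of the antennas, $P$ is the law of $$\mathbf H=\begin{bmatrix}\Re\tilde{\mathbf H}&-\Im\tilde{\mathbf H}\\ \Im\tilde{\mathbf H}&\Re\tilde{\mathbf H}\end{bmatrix},\qquad \mathbf y=\begin{bmatrix}\Re\tilde{\mathbf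 y}\\ \Im\tilde{\mathbf y}\end{bmatrix}$$ for a random pair $(\tilde{\mathbf H},\tilde{\mathbf y})\in\mathbb C^{N_r\times N_t}\times\mathbb C^{N_r}$ whose law is absolutely continuous with respect to Lebesgue measure. Let $f_{ML}$ be any ML detector. Then for every $\epsilon>0$ and $0<\delta<1$ there is a function $f$ represented by a ChannelNet-MLP with activation $\sigma$ such that the event $\{(\mathbf H,\mathbf y)\in X:\|f_{ML}(\mathbf H,\mathbf y)-f(\mathbf H,\mathbf y)\|_2<\epsilon\}$ is measurable for the completion of $P$ and $$P\big(\{(\mathbf H,\mathbf y)\in X:\|f_{ML}(\mathbf H,\mathbf y)-f(\mathbf H,\mathbf y)\|_2<\epsilon\}\big)>1-\delta .$$ -/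

import Mathlib

open MeasureTheory
open scoped Matrix

noncomputable section

/-- The inputs of a detector: a real channel matrix `H` (`N` receive and `K` transmit antennas)
and a received vector `y`, that is, a point of `ℝ^(N × (K + 1))`. -/
abbrev ChannelData (N K : ℕ) : Type :=
  (Fin N → Fin K → ℝ) × (Fin N → ℝ)

/-- The squared Euclidean distance `‖y - H x‖²`. -/
def sqResidual {N K : ℕ} (p : ChannelData N K) (x : Fin K → ℝ) : ℝ :=
  ∑ i, (p.2 i - ∑ j, p.1 i j * x j) ^ 2

/-- `g` is a maximum-likelihood detector for the finite real constellation `C`: at every input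
`(H, y)` its value is a minimiser of `x ↦ ‖y - H x‖²` over `C^K`. (The minimiser may fail to be
unique at some inputs; every choice of minimisers is allowed.) -/
def IsMLDetector {N K : ℕ} (C : Finset ℝ) (g : ChannelData N K → EuclideanSpace ℝ (Fin K)) :
    Prop :=
  ∀ p : ChannelData N K, (∀ j, g p j ∈ C) ∧
    ∀ x : Fin K → ℝ, (∀ j, x j ∈ C) → sqResidual p (fun j => g p j) ≤ sqResidual p x

/-- Multilayer perceptrons with activation `σ`: an affine map, or an affine map followed by the
coordinatewise activation and by a multilayer perceptron. -/
inductive IsMLP (σ : ℝ → ℝ) : {m n : ℕ} → ((Fin m → ℝ) → (Fin n → ℝ)) → Prop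
  | affine {m n : ℕ} (A : Matrix (Fin n) (Fin m) ℝ) (b : Fin n → ℝ) :
      IsMLP σ (fun x => A *ᵥ x + b)
  | layer {m k n : ℕ} (A : Matrix (Fin k) (Fin m) ℝ) (b : Fin k → ℝ)
      (g : (Fin k → ℝ) → (Fin n → ℝ)) (hg : IsMLP σ g) :
      IsMLP σ (fun x => g (fun i => σ ((A *ᵥ x + b) i)))

/-- The antenna feature processors of a ChannelNet-MLP with feature dimension `d` and `l + 1`
iterations. Each of them is a multilayer perceptron, shared by all antennas:
* `phiIn` is the receive processor of the first iteration, fed with the scalars `y i`;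
* `phi t`, for `t < l`, is the receive processor of iteration `t + 2`;
* `psi t`, for `t < l`, is the transmit processor of iteration `t + 1`;
* `psiOut` is the transmit processor of the last iteration, with a scalar output per antenna. -/
structure ChannelNetMLP (σ : ℝ → ℝ) (d l : ℕ) where
  phiIn : (Fin 1 → ℝ) → (Fin d → ℝ)
  phi : Fin l → (Fin d → ℝ) → (Fin d → ℝ)
  psi : Fin l → (Fin d → ℝ) → (Fin d → ℝ)
  psiOut : (Fin d → ℝ) → (Fin 1 → ℝ)
  phiIn_mlp : IsMLP σ phiIn
  phi_mlp : ∀ t, IsMLP σ (phi t)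
  psi_mlp : ∀ t, IsMLP σ (psi t)
  psiOut_mlp : IsMLP σ psiOut

namespace ChannelNetMLP

variable {σ : ℝ → ℝ} {d l N K : ℕ}

/-- Channel layer from receive to transmit features: `F ↦ Hᵀ F`. -/
def toTx (p : ChannelData N K) (F : Fin N → Fin d → ℝ) : Fin K → Fin d → ℝ :=
  fun j a => ∑ i, p.1 i j * F i a

/-- Channel layer from transmit to receive features, followed by the subtraction of the received
vector in every feature dimension: `F ↦ H F - y 1ᵀ`. -/
def toRx (p : ChannelData N K) (F : Fin K → Fin d → ℝ) : Fin N → Fin d → ℝ :=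
  fun i a => ∑ j, p.1 i j * F j a - p.2 i

/-- The transmit features of iteration `t + 1`, after the skip connection and before the transmit
processor is applied. -/
def txFeature (net : ChannelNetMLP σ d l) (p : ChannelData N K) :
    (t : ℕ) → t ≤ l → Fin K → Fin d → ℝ
  | 0, _ => toTx p (fun i => net.phiIn (fun _ => p.2 i))
  | t + 1, h =>
      let old := net.txFeature p t (Nat.le_of_succ_le h)
      let rx := toRx p (fun j => net.psi ⟨t, h⟩ (old j))
      toTx p (fun i => net.phi ⟨t, h⟩ (rx i)) + old

/-- The function computed by a ChannelNet-MLP. -/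
def eval (net : ChannelNetMLP σ d l) (p : ChannelData N K) : EuclideanSpace ℝ (Fin K) :=
  WithLp.toLp 2 (fun j => net.psiOut (net.txFeature p l le_rfl j) 0)

end ChannelNetMLP

/-- `f` is represented by a ChannelNet-MLP with activation `σ`, of some feature dimension and some
(positive) number of iterations. -/
def IsChannelNetMLP {N K : ℕ} (σ : ℝ → ℝ) (f : ChannelData N K → EuclideanSpace ℝ (Fin K)) :
    Prop :=
  ∃ (d l : ℕ) (net : ChannelNetMLP σ d l), ∀ p, f p = net.eval p

/-- The real representation of a complex channel `(H̃, ỹ)`: the matrix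
`[[Re H̃, -Im H̃], [Im H̃, Re H̃]]` and the vector `[Re ỹ, Im ỹ]`. The bijections `eN`, `eK` label
the `2 Nr` real receive antennas and the `2 Nt` real transmit antennas. -/
def realRepr {Nr Nt N K : ℕ} (eN : Fin Nr ⊕ Fin Nr ≃ Fin N) (eK : Fin Nt ⊕ Fin Nt ≃ Fin K)
    (q : (Fin Nr → Fin Nt → ℂ) × (Fin Nr → ℂ)) : ChannelData N K :=
  let R : Matrix (Fin Nr) (Fin Nt) ℝ := fun i j => (q.1 i j).re
  let I : Matrix (Fin Nr) (Fin Nt) ℝ := fun i j => (q.1 i j).im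
  (fun i j => Matrix.fromBlocks R (-I) I R (eN.symm i) (eK.symm j),
    fun i => Sum.elim (fun k => (q.2 k).re) (fun k => (q.2 k).im) (eN.symm i))

/-- The channel matrix and the received vector have a (jointly) continuous distribution `P`: it has
a density with respect to Lebesgue measure on `ℝ^(N × (K + 1))`, or it is the law of the real
representation of a complex channel matrix and a complex received vector that have one. -/
def HasContinuousDistribution {N K : ℕ} (P : Measure (ChannelData N K)) : Prop :=
  P ≪ volume ∨
    ∃ (Nr Nt : ℕ) (eN : Fin Nr ⊕ Fin Nr ≃ Fin N) (eK : Fin Nt ⊕ Fin Nt ≃ Fin K),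
      P ≪ Measure.map (realRepr eN eK) volume

end

/-!
A two-iteration ChannelNet whose processors are arbitrary continuous maps computes the
maximum-likelihood detector exactly on every compact set of generic inputs, and perceptrons are dense
among continuous maps.

*Genericity.* Call an input generic (`IsGeneric`) if the entries of `H` are nonzero, those of each
row are distinct, those of `y` are distinct, and the residuals of different transmit vectors differ.
These are the nonvanishing conditions of finitely many linear and quadratic forms, none of which is zero, so
they hold on an open set of full measure (`HasContinuousDistribution.ae_isGeneric`), also for the
real representation of a complex channel. At generic inputs the detector is locally constant and
equivariant under relabellings of the antennas.

*Separation.* A message `∑ i, H i j * θ (F i)` with enough continuous functions `θ` determines the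
points `F i` with their weights `H i j`, if the points are distinct and the weights nonzero
(`exists_moments`). As `y` labels the receive antennas,
the first iteration tells a transmit antenna its column; as the columns label the transmit antennas,
the second tells it the whole input up to a relabelling
(`exists_twoStepFeature_separating`). By equivariance the detector is a function of the transmit
features, and by compactness and the Tietze extension theorem a continuous one
(`IsMLDetector.exists_twoStepEval_eq`).

*Approximation.* The function computed depends continuously, in the compact-open topology, on the
processors, so it suffices that perceptrons are dense (`dense_isMLP`). Let `V` be the closed span of
the functions `t ↦ σ (w t + b)` in `C(ℝ, ℝ)`. If `V` misses a monomial `t ^ k`, then `σ` is a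
polynomial (`pow_mem_or_mem_polyFun`); otherwise `V` is everything by the Stone–Weierstrass theorem,
and several variables follow with the exponential ridge functions.

Inner regularity then provides a compact set of generic inputs of probability above `1 - δ`.
-/

/-! ### Closed subspaces of continuous functions and the monomials they contain -/

/-- A closed subspace of a locally convex space is the intersection of the kernels of the
continuous functionals vanishing on it. -/
theorem Submodule.mem_of_forall_dual_eq_zero {E : Type*} [TopologicalSpace E] [AddCommGroup E]
    [Module ℝ E] [IsTopologicalAddGroup E] [ContinuousSMul ℝ E] [LocallyConvexSpace ℝ E]
    (V : Submodule ℝ E) (hV : IsClosed (V : Set E)) (x : E)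
    (h : ∀ l : StrongDual ℝ E, (∀ v ∈ V, l v = 0) → l x = 0) : x ∈ V := by
  by_contra hx
  obtain ⟨l, u, hxu, hu⟩ := geometric_hahn_banach_point_closed V.convex hV hx
  have hu0 : u < 0 := by simpa using hu 0 V.zero_mem
  -- A functional bounded below on a subspace vanishes there.
  have hl : ∀ v ∈ V, l v = 0 := by
    intro v hv
    by_contra hne
    have := hu ((u / l v) • v) (V.smul_mem _ hv)
    simp [hne] at this
  have := h l hl
  linarith

/-- The function `t ↦ F (s, t)` of a jointly continuous `F`, as a point of `C(ℝ, ℝ)`. -/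
def sliceMap (F : C(ℝ × ℝ, ℝ)) (s : ℝ) : C(ℝ, ℝ) := ⟨fun t => F (s, t), by fun_prop⟩

/-- The function `t ↦ ∫ s in a..b, F (s, t)` of a jointly continuous `F`. -/
noncomputable def integralMap (F : C(ℝ × ℝ, ℝ)) (a b : ℝ) : C(ℝ, ℝ) :=
  ⟨fun t => ∫ s in a..b, F (s, t),
    intervalIntegral.continuous_parametric_intervalIntegral_of_continuous'
      (f := fun t s => F (s, t)) (by simp only [Function.uncurry_def]; fun_prop) a b⟩

/-- If all slices of `F` lie in a closed subspace of `C(ℝ, ℝ)`, then so does their integral: for a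
functional `l` vanishing on the subspace, `r ↦ l (∫ s in 0..r, F (s, ·))` has derivative
`l (F (r, ·)) = 0`. -/
theorem integralMap_mem (V : Submodule ℝ C(ℝ, ℝ)) (hV : IsClosed (V : Set C(ℝ, ℝ)))
    (F : C(ℝ × ℝ, ℝ)) (hF : ∀ s, sliceMap F s ∈ V) : integralMap F 0 1 ∈ V := by
  refine V.mem_of_forall_dual_eq_zero hV _ fun l hl => ?_
  have hderiv : ∀ r, HasDerivAt (fun r => l (integralMap F 0 r)) 0 r := by
    intro r
    let Q : ℝ → C(ℝ, ℝ) := fun h => ⟨fun t => ∫ s in (0 : ℝ)..1, F (r + h * s, t),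
      intervalIntegral.continuous_parametric_intervalIntegral_of_continuous'
        (f := fun t s => F (r + h * s, t)) (by simp only [Function.uncurry_def]; fun_prop) 0 1⟩
    have hQ : Continuous Q := by
      refine ContinuousMap.continuous_of_continuous_uncurry _ ?_
      exact intervalIntegral.continuous_parametric_intervalIntegral_of_continuous'
        (f := fun (p : ℝ × ℝ) s => F (r + p.1 * s, p.2))
        (by simp only [Function.uncurry_def]; fun_prop) 0 1
    have hQ0 : Q 0 = sliceMap F r := by
      ext t; simp [Q, sliceMap]
    have hstep : ∀ h, h ≠ 0 → h⁻¹ • (integralMap F 0 (r + h) - integralMap F 0 r) = Q h := by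
      intro h hh
      ext t
      have hint : ∀ a b, IntervalIntegrable (fun s => F (s, t)) volume a b := fun a b =>
        Continuous.intervalIntegrable (by fun_prop) a b
      have h1 : (∫ s in (0 : ℝ)..(r + h), F (s, t)) - ∫ s in (0 : ℝ)..r, F (s, t)
          = ∫ s in r..(r + h), F (s, t) :=
        intervalIntegral.integral_interval_sub_left (hint _ _) (hint _ _)
      have h2 := intervalIntegral.integral_comp_add_mul (a := (0 : ℝ)) (b := 1)
        (fun s => F (s, t)) hh r
      simp only [mul_zero, add_zero, mul_one] at h2
      simp [integralMap, Q, h1, h2]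
    rw [hasDerivAt_iff_tendsto_slope_zero]
    have hlim : Filter.Tendsto (fun h => l (Q h)) (nhdsWithin 0 {0}ᶜ) (nhds 0) := by
      have h0 : l (Q 0) = 0 := by rw [hQ0]; exact hl _ (hF r)
      have hc : Continuous fun h => l (Q h) := l.continuous.comp hQ
      simpa only [h0] using (hc.tendsto 0).mono_left nhdsWithin_le_nhds
    refine hlim.congr' ?_
    filter_upwards [self_mem_nhdsWithin] with h hh
    rw [← hstep h hh]
    simp
  have hconst := is_const_of_deriv_eq_zero (fun r => (hderiv r).differentiableAt)
    (fun r => (hderiv r).deriv) 1 0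
  have h00 : integralMap F 0 0 = 0 := by ext t; simp [integralMap]
  simpa [h00] using hconst

/-- The space of polynomial functions on `ℝ` of degree less than `k`. -/
def polyFun (k : ℕ) : Submodule ℝ (ℝ → ℝ) :=
  Submodule.span ℝ (Set.range fun i : Fin k => fun t : ℝ => t ^ (i : ℕ))

theorem isClosed_polyFun (k : ℕ) : IsClosed (polyFun k : Set (ℝ → ℝ)) := by
  have : FiniteDimensional ℝ (polyFun k) :=
    FiniteDimensional.span_of_finite ℝ (Set.finite_range _)
  exact Submodule.closed_of_finiteDimensional _

theorem exists_polynomial_of_mem_polyFun {k : ℕ} {g : ℝ → ℝ} (hg : g ∈ polyFun k) :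
    ∃ q : Polynomial ℝ, ∀ t, g t = q.eval t := by
  induction hg using Submodule.span_induction with
  | mem x hx => obtain ⟨i, rfl⟩ := hx; exact ⟨Polynomial.X ^ (i : ℕ), by simp⟩
  | zero => exact ⟨0, by simp⟩
  | add x y _ _ hx hy =>
    obtain ⟨p, hp⟩ := hx
    obtain ⟨q, hq⟩ := hy
    exact ⟨p + q, by simp [hp, hq]⟩
  | smul a x _ hx =>
    obtain ⟨p, hp⟩ := hx
    exact ⟨Polynomial.C a * p, by simp [hp]⟩

theorem exists_hasDerivAt_of_mem_polyFun {k : ℕ} {g : ℝ → ℝ} (hg : g ∈ polyFun k) :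
    ∃ G ∈ polyFun (k + 1), ∀ t, HasDerivAt G (g t) t := by
  induction hg using Submodule.span_induction with
  | mem x hx =>
    obtain ⟨i, rfl⟩ := hx
    refine ⟨((i : ℝ) + 1)⁻¹ • fun t : ℝ => t ^ ((i : ℕ) + 1),
      Submodule.smul_mem _ _ (Submodule.subset_span ⟨i.succ, by simp⟩), fun t => ?_⟩
    have h := (hasDerivAt_pow ((i : ℕ) + 1) t).const_smul ((i : ℝ) + 1)⁻¹
    refine h.congr_deriv ?_
    have : (i : ℝ) + 1 ≠ 0 := by positivity
    simp
    field_simp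
  | zero => exact ⟨0, Submodule.zero_mem _, fun t => hasDerivAt_const t 0⟩
  | add x y _ _ hx hy =>
    obtain ⟨p, hp, hp'⟩ := hx
    obtain ⟨q, hq, hq'⟩ := hy
    exact ⟨p + q, Submodule.add_mem _ hp hq, fun t => (hp' t).add (hq' t)⟩
  | smul a x _ hx =>
    obtain ⟨p, hp, hp'⟩ := hx
    exact ⟨a • p, Submodule.smul_mem _ _ hp, fun t => (hp' t).const_smul a⟩

theorem mem_polyFun_of_hasDerivAt {k : ℕ} {f g : ℝ → ℝ} (hg : g ∈ polyFun k)
    (h : ∀ t, HasDerivAt f (g t) t) : f ∈ polyFun (k + 1) := by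
  obtain ⟨G, hG, hG'⟩ := exists_hasDerivAt_of_mem_polyFun hg
  have hd : ∀ t, HasDerivAt (f - G) 0 t := fun t => by simpa using (h t).sub (hG' t)
  have hconst : ∀ t, (f - G) t = (f - G) 0 := fun t =>
    is_const_of_deriv_eq_zero (fun r => (hd r).differentiableAt) (fun r => (hd r).deriv) t 0
  have hf : f = G + (f - G) 0 • fun t : ℝ => t ^ (((0 : Fin (k + 1)) : ℕ)) := by
    ext t
    have := hconst t
    simp only [Pi.sub_apply] at this
    simp
    linarith
  rw [hf]
  exact Submodule.add_mem _ hG (Submodule.smul_mem _ _ (Submodule.subset_span ⟨0, rfl⟩))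

/-- The function `t ↦ g (w t + b)`. -/
def affineComp (g : C(ℝ, ℝ)) (w b : ℝ) : C(ℝ, ℝ) := ⟨fun t => g (w * t + b), by fun_prop⟩

/-- The average `t ↦ ∫ s in 0..1, g (t + h s)` of `g` over the segment from `t` to `t + h`. -/
noncomputable def boxAverage (g : C(ℝ, ℝ)) (h : ℝ) : C(ℝ, ℝ) :=
  integralMap ⟨fun p => g (p.2 + h * p.1), by fun_prop⟩ 0 1

theorem boxAverage_apply (g : C(ℝ, ℝ)) (h t : ℝ) :
    boxAverage g h t = ∫ s in (0 : ℝ)..1, g (t + h * s) := rfl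

theorem hasDerivAt_boxAverage (g : C(ℝ, ℝ)) {h : ℝ} (hh : h ≠ 0) (t : ℝ) :
    HasDerivAt (boxAverage g h) (h⁻¹ * (g (t + h) - g t)) t := by
  have hint : ∀ a b, IntervalIntegrable g volume a b := fun a b =>
    g.continuous.intervalIntegrable a b
  have hG : ∀ t, HasDerivAt (fun r => ∫ s in (0 : ℝ)..r, g s) (g t) t := fun t =>
    intervalIntegral.integral_hasDerivAt_right (hint _ _)
      (g.continuous.stronglyMeasurableAtFilter _ _) g.continuous.continuousAt
  have heq : ∀ t, boxAverage g h t
      = h⁻¹ * ((∫ s in (0 : ℝ)..(t + h), g s) - ∫ s in (0 : ℝ)..t, g s) := by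
    intro t
    have h2 := intervalIntegral.integral_comp_add_mul (a := (0 : ℝ)) (b := 1) g hh t
    simp only [mul_zero, add_zero, mul_one] at h2
    rw [boxAverage_apply, h2, intervalIntegral.integral_interval_sub_left (hint _ _) (hint _ _)]
    rfl
  have := (((hG (t + h)).comp_add_const t h).sub (hG t)).const_mul h⁻¹
  exact this.congr_of_eventuallyEq (Filter.Eventually.of_forall heq)

/-- If a closed subspace `V` contains all `t ↦ g (w t + b)`, then it contains all
`t ↦ t u (w t + b)`, where `u` is the derivative of a box average of `g`: differentiate with
respect to `w`. -/
theorem mul_affineComp_mem (V : Submodule ℝ C(ℝ, ℝ)) (hV : IsClosed (V : Set C(ℝ, ℝ)))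
    (g : C(ℝ, ℝ)) (hg : ∀ w b, affineComp g w b ∈ V) {h : ℝ} (hh : h ≠ 0) (u : C(ℝ, ℝ))
    (hu : ∀ t, u t = h⁻¹ * (g (t + h) - g t)) (w b : ℝ) :
    ContinuousMap.id ℝ * affineComp u w b ∈ V := by
  have hA : ∀ w b, affineComp (boxAverage g h) w b ∈ V := by
    intro w b
    have := integralMap_mem V hV ⟨fun p => g (w * p.2 + (b + h * p.1)), by fun_prop⟩
      (fun s => hg w (b + h * s))
    convert this using 1
    ext t
    simp [affineComp, boxAverage, integralMap, add_assoc]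
  let Q : ℝ → C(ℝ, ℝ) := fun r => ⟨fun t => ∫ s in (0 : ℝ)..1, t * u (w * t + b + s * (r * t)),
      intervalIntegral.continuous_parametric_intervalIntegral_of_continuous'
        (f := fun t s => t * u (w * t + b + s * (r * t)))
        (by simp only [Function.uncurry_def]; fun_prop) 0 1⟩
  have hQ : Continuous Q := by
    refine ContinuousMap.continuous_of_continuous_uncurry _ ?_
    exact intervalIntegral.continuous_parametric_intervalIntegral_of_continuous'
      (f := fun (p : ℝ × ℝ) s => p.2 * u (w * p.2 + b + s * (p.1 * p.2)))
      (by simp only [Function.uncurry_def]; fun_prop) 0 1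
  have hQ0 : Q 0 = ContinuousMap.id ℝ * affineComp u w b := by
    ext t; simp [Q, affineComp]
  have hstep : ∀ r, r ≠ 0 → Q r ∈ V := by
    intro r hr
    have : Q r = r⁻¹ • (affineComp (boxAverage g h) (w + r) b
        - affineComp (boxAverage g h) w b) := by
      ext t
      have hder : ∀ s ∈ Set.uIcc (0 : ℝ) 1,
          HasDerivAt (fun s => boxAverage g h (w * t + b + s * (r * t)))
            (r * (t * u (w * t + b + s * (r * t)))) s := by
        intro s _
        have h1 : HasDerivAt (fun s => w * t + b + s * (r * t)) (r * t) s := by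
          simpa using ((hasDerivAt_id s).mul_const (r * t)).const_add (w * t + b)
        have h2 := (hasDerivAt_boxAverage g hh (w * t + b + s * (r * t))).comp s h1
        rw [← hu] at h2
        exact h2.congr_deriv (by ring)
      have hI := intervalIntegral.integral_eq_sub_of_hasDerivAt hder
        (Continuous.intervalIntegrable (by fun_prop) _ _)
      rw [intervalIntegral.integral_const_mul] at hI
      have e1 : w * t + b + 1 * (r * t) = (w + r) * t + b := by ring
      have e2 : w * t + b + 0 * (r * t) = w * t + b := by ring
      rw [e1, e2] at hI
      simp only [Q, affineComp, ContinuousMap.coe_mk, ContinuousMap.smul_apply,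
        ContinuousMap.sub_apply, smul_eq_mul]
      rw [← hI, inv_mul_cancel_left₀ hr]
    rw [this]
    exact V.smul_mem _ (V.sub_mem (hA _ _) (hA _ _))
  rw [← hQ0]
  refine hV.mem_of_tendsto ((hQ.tendsto 0).mono_left (nhdsWithin_le_nhds (s := ({0} : Set ℝ)ᶜ))) ?_
  filter_upwards [self_mem_nhdsWithin] with r hr using hstep r hr

/-- A continuous `g` all of whose affine reparametrisations lie in a closed subspace `V` not
containing `t ^ k` is a polynomial of degree less than `k`. By induction on `k`: for the subspace
of all `u` with `t u ∈ V`, the induction hypothesis applies to the difference quotients of `g`, so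
the box averages of `g` are polynomials of degree at most `k`, and `g` is their limit. -/
theorem pow_mem_or_mem_polyFun (k : ℕ) (V : Submodule ℝ C(ℝ, ℝ))
    (hV : IsClosed (V : Set C(ℝ, ℝ))) (g : C(ℝ, ℝ)) (hg : ∀ w b, affineComp g w b ∈ V) :
    ContinuousMap.id ℝ ^ k ∈ V ∨ (g : ℝ → ℝ) ∈ polyFun k := by
  induction k generalizing V g with
  | zero =>
    rw [or_iff_not_imp_right]
    intro hne
    obtain ⟨b, hb⟩ : ∃ b, g b ≠ 0 := by
      by_contra! h
      refine hne ?_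
      have : (g : ℝ → ℝ) = 0 := funext h
      rw [this]
      exact Submodule.zero_mem _
    have : (ContinuousMap.id ℝ ^ 0 : C(ℝ, ℝ)) = (g b)⁻¹ • affineComp g 0 b := by
      ext t; simp [affineComp, hb]
    rw [this]
    exact V.smul_mem _ (hg 0 b)
  | succ k ih =>
    rw [or_iff_not_imp_left]
    intro hk
    let V' : Submodule ℝ C(ℝ, ℝ) := V.comap (LinearMap.mulLeft ℝ (ContinuousMap.id ℝ))
    have hV' : IsClosed (V' : Set C(ℝ, ℝ)) :=
      hV.preimage (continuous_const.mul continuous_id)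
    have hk' : ContinuousMap.id ℝ ^ k ∉ V' := by
      intro h
      apply hk
      rw [pow_succ']
      exact h
    have hbox : ∀ h, h ≠ 0 → (boxAverage g h : ℝ → ℝ) ∈ polyFun (k + 1) := by
      intro h hh
      let u : C(ℝ, ℝ) := ⟨fun t => h⁻¹ * (g (t + h) - g t), by fun_prop⟩
      have hu := (ih V' hV' u fun w b =>
        mul_affineComp_mem V hV g hg hh u (fun _ => rfl) w b).resolve_left hk'
      exact mem_polyFun_of_hasDerivAt hu (hasDerivAt_boxAverage g hh)
    have hlim : Filter.Tendsto (fun h => (boxAverage g h : ℝ → ℝ)) (nhdsWithin 0 {0}ᶜ)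
        (nhds g) := by
      rw [tendsto_pi_nhds]
      intro t
      have hc : Continuous fun h => boxAverage g h t :=
        intervalIntegral.continuous_parametric_intervalIntegral_of_continuous'
          (f := fun h s => g (t + h * s)) (by simp only [Function.uncurry_def]; fun_prop) 0 1
      have := (hc.tendsto 0).mono_left (nhdsWithin_le_nhds (s := ({0} : Set ℝ)ᶜ))
      simpa [boxAverage_apply] using this
    refine (isClosed_polyFun (k + 1)).mem_of_tendsto hlim ?_
    filter_upwards [self_mem_nhdsWithin] with h hh using hbox h hh

/-! ### Density of multilayer perceptrons -/

/-- The Stone–Weierstrass theorem in the compact-open topology. -/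
theorem Submodule.eq_top_of_separatesPoints {X : Type*} [TopologicalSpace X]
    (V : Submodule ℝ C(X, ℝ)) (hV : IsClosed (V : Set C(X, ℝ))) (A : Subalgebra ℝ C(X, ℝ))
    (hA : A.SeparatesPoints) (hAV : ∀ f ∈ A, f ∈ V) : V = ⊤ := by
  rw [eq_top_iff]
  intro f _
  change f ∈ (V : Set C(X, ℝ))
  rw [← hV.closure_eq, mem_closure_iff_nhds_basis
    (nhds_basis_uniformity Metric.uniformity_basis_dist.compactConvergenceUniformity)]
  rintro ⟨K, ε⟩ ⟨hK, hε⟩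
  obtain ⟨g, hg, hgf⟩ :=
    ContinuousMap.exists_mem_subalgebra_near_continuous_of_isCompact_of_separatesPoints hA f hK hε
  exact ⟨g, hAV g hg, fun x hx => by simpa [Real.dist_eq] using hgf x hx⟩

theorem Submodule.eq_top_of_forall_pow_mem (V : Submodule ℝ C(ℝ, ℝ))
    (hV : IsClosed (V : Set C(ℝ, ℝ))) (h : ∀ k : ℕ, ContinuousMap.id ℝ ^ k ∈ V) : V = ⊤ := by
  refine V.eq_top_of_separatesPoints hV (Algebra.adjoin ℝ {ContinuousMap.id ℝ}) ?_ ?_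
  · intro x y hxy
    exact ⟨_, ⟨ContinuousMap.id ℝ, Algebra.self_mem_adjoin_singleton _ _, rfl⟩, hxy⟩
  · intro f hf
    rw [← Subalgebra.mem_toSubmodule, Algebra.adjoin_eq_span] at hf
    refine Submodule.span_le.2 ?_ hf
    intro g hg
    obtain ⟨k, rfl⟩ := Submonoid.mem_closure_singleton.1 hg
    exact h k

/-- The ridge function `x ↦ g (w · x)`. -/
def ridge {m : ℕ} (g : C(ℝ, ℝ)) (w : Fin m → ℝ) : C(Fin m → ℝ, ℝ) :=
  ⟨fun x => g (w ⬝ᵥ x), g.continuous.comp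
    (show Continuous fun x => w ⬝ᵥ x by simp only [dotProduct]; fun_prop)⟩

/-- A closed subspace containing all ridge functions is everything, since the exponential ridge
functions span an algebra that separates points. -/
theorem Submodule.eq_top_of_forall_ridge_mem {m : ℕ} (V : Submodule ℝ C(Fin m → ℝ, ℝ))
    (hV : IsClosed (V : Set C(Fin m → ℝ, ℝ))) (h : ∀ g w, ridge g w ∈ V) : V = ⊤ := by
  let e : C(ℝ, ℝ) := ⟨Real.exp, Real.continuous_exp⟩
  let M : Submonoid C(Fin m → ℝ, ℝ) :=
    { carrier := Set.range (ridge e)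
      one_mem' := ⟨0, by ext x; simp [ridge, e]⟩
      mul_mem' := by
        rintro _ _ ⟨w, rfl⟩ ⟨w', rfl⟩
        exact ⟨w + w', by ext x; simp [ridge, e, add_dotProduct, Real.exp_add]⟩ }
  refine V.eq_top_of_separatesPoints hV (Algebra.adjoin ℝ (M : Set C(Fin m → ℝ, ℝ))) ?_ ?_
  · intro x y hxy
    obtain ⟨i, hi⟩ := Function.ne_iff.1 hxy
    refine ⟨_, ⟨ridge e (Pi.single i 1), Algebra.subset_adjoin ⟨_, rfl⟩, rfl⟩, ?_⟩
    simpa [ridge, e] using hi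
  · intro f hf
    rw [← Subalgebra.mem_toSubmodule, Algebra.adjoin_eq_span, Submonoid.closure_eq] at hf
    refine Submodule.span_le.2 ?_ hf
    rintro _ ⟨w, rfl⟩
    exact h e w

/-- The hidden unit `x ↦ σ (w · x + b)`. -/
def hiddenUnit {m : ℕ} (σ : C(ℝ, ℝ)) (p : (Fin m → ℝ) × ℝ) : C(Fin m → ℝ, ℝ) :=
  ⟨fun x => σ (p.1 ⬝ᵥ x + p.2), σ.continuous.comp (by simp only [dotProduct]; fun_prop)⟩

/-- Scalar universal approximation: for a continuous activation that is not a polynomial, the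
hidden units span a dense subspace. -/
theorem dense_span_hiddenUnit (m : ℕ) (σ : C(ℝ, ℝ))
    (hσ : ¬ ∃ q : Polynomial ℝ, ∀ t, σ t = q.eval t) :
    Dense (Submodule.span ℝ (Set.range (hiddenUnit (m := m) σ)) : Set C(Fin m → ℝ, ℝ)) := by
  rw [Submodule.dense_iff_topologicalClosure_eq_top]
  set V := (Submodule.span ℝ (Set.range (hiddenUnit (m := m) σ))).topologicalClosure
  have hV : IsClosed (V : Set C(Fin m → ℝ, ℝ)) := Submodule.isClosed_topologicalClosure _
  refine V.eq_top_of_forall_ridge_mem hV fun g w => ?_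
  let l : C(Fin m → ℝ, ℝ) := ⟨fun x => w ⬝ᵥ x, by simp only [dotProduct]; fun_prop⟩
  let W : Submodule ℝ C(ℝ, ℝ) := V.comap (ContinuousMap.compRightAlgHom ℝ ℝ l).toLinearMap
  have hW : IsClosed (W : Set C(ℝ, ℝ)) := hV.preimage (ContinuousMap.continuous_precomp l)
  have hσW : ∀ a b, affineComp σ a b ∈ W := by
    intro a b
    refine Submodule.le_topologicalClosure _ (Submodule.subset_span ⟨(a • w, b), ?_⟩)
    ext x
    simp [hiddenUnit, affineComp, l]
  have hWtop : W = ⊤ := W.eq_top_of_forall_pow_mem hW fun k =>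
    (pow_mem_or_mem_polyFun k W hW σ hσW).resolve_right fun h =>
      hσ (exists_polynomial_of_mem_polyFun h)
  have : g ∈ W := hWtop ▸ Submodule.mem_top
  exact this

/-- Universal approximation: multilayer perceptrons with a continuous activation that is not a
polynomial are dense in the compact-open topology; one hidden layer suffices. -/
theorem dense_isMLP (m n : ℕ) (σ : ℝ → ℝ) (hσ : Continuous σ)
    (hσ_poly : ¬ ∃ q : Polynomial ℝ, ∀ t, σ t = q.eval t) :
    Dense {f : C(Fin m → ℝ, Fin n → ℝ) | IsMLP σ f} := by
  let s : C(ℝ, ℝ) := ⟨σ, hσ⟩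
  let S := (Submodule.span ℝ (Set.range (hiddenUnit (m := m) s)) : Set C(Fin m → ℝ, ℝ))
  let Φ : (Fin n → C(Fin m → ℝ, ℝ)) → C(Fin m → ℝ, Fin n → ℝ) := ContinuousMap.pi
  have hΦ : Continuous Φ := by
    refine ContinuousMap.continuous_of_continuous_uncurry _ ?_
    simp only [Function.uncurry_def, Φ, ContinuousMap.pi]
    exact continuous_pi fun i => by simp only [ContinuousMap.coe_mk]; fun_prop
  have hsurj : Function.Surjective Φ := fun F =>
    ⟨fun i => ⟨fun x => F x i, by fun_prop⟩, by ext; rfl⟩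
  have hS : Dense (Set.univ.pi fun _ : Fin n => S) :=
    dense_pi _ fun _ _ => dense_span_hiddenUnit m s hσ_poly
  refine (hsurj.denseRange.dense_image hΦ hS).mono ?_
  rintro _ ⟨f, hf, rfl⟩
  have hf' : ∀ a, ∃ c : ((Fin m → ℝ) × ℝ) →₀ ℝ, (c.sum fun i r => r • hiddenUnit s i) = f a :=
    fun a => Finsupp.mem_span_range_iff_exists_finsupp.1 (hf a trivial)
  choose c hc using hf'
  classical
  -- The hidden layer holds the units of all output coordinates.
  let T : Finset ((Fin m → ℝ) × ℝ) := Finset.univ.biUnion fun a => (c a).support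
  let e := T.equivFin
  have hval : ∀ a x, f a x = ∑ k, c a (e.symm k) * σ ((e.symm k : (Fin m → ℝ) × ℝ).1 ⬝ᵥ x
      + (e.symm k : (Fin m → ℝ) × ℝ).2) := by
    intro a x
    rw [Equiv.sum_comp e.symm (fun k : T => c a k * σ ((k : (Fin m → ℝ) × ℝ).1 ⬝ᵥ x
      + (k : (Fin m → ℝ) × ℝ).2)), Finset.sum_coe_sort T
      (fun k => c a k * σ (k.1 ⬝ᵥ x + k.2)), ← hc a,
      Finsupp.sum_of_support_subset _ (s := T)
        (Finset.subset_biUnion_of_mem (fun a => (c a).support) (Finset.mem_univ a)) _ (by simp)]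
    simp [hiddenUnit, s]
  have := IsMLP.layer (σ := σ) (Matrix.of fun k => (e.symm k : (Fin m → ℝ) × ℝ).1)
    (fun k => (e.symm k : (Fin m → ℝ) × ℝ).2) _
    (IsMLP.affine (Matrix.of fun a k => c a (e.symm k)) 0)
  change IsMLP σ (Φ f : (Fin m → ℝ) → Fin n → ℝ)
  convert this using 1
  ext x a
  simp [Φ, hval, Matrix.mulVec, dotProduct]

/-! ### Moments of weighted point sets -/

/-- For every `r` there are finitely many continuous functions on `ℝ^ι` whose linear combinations
interpolate arbitrary values on every set of at most `r` points: products of at most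
`r` affine functions of one coordinate span a finite-dimensional space, which contains for each point
of such a set a function equal to `1` there and to `0` at the other points. -/
theorem exists_interpolating_family (ι : Type*) [Finite ι] (r : ℕ) :
    ∃ (M : ℕ) (θ : Fin M → C(ι → ℝ, ℝ)), ∀ s : Finset (ι → ℝ), s.card ≤ r →
      ∀ g : (ι → ℝ) → ℝ, ∃ c : Fin M → ℝ, ∀ z ∈ s, ∑ k, c k * θ k z = g z := by
  classical
  let X : ι → C(ι → ℝ, ℝ) := fun i => ⟨fun x => x i, by fun_prop⟩
  let W : Submodule ℝ C(ι → ℝ, ℝ) := Submodule.span ℝ (insert 1 (Set.range X))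
  have hW1 : (1 : C(ι → ℝ, ℝ)) ∈ W := Submodule.subset_span (Set.mem_insert _ _)
  have hWX : ∀ i, X i ∈ W := fun i =>
    Submodule.subset_span (Set.mem_insert_of_mem _ ⟨i, rfl⟩)
  have hfg : (W ^ r).FG :=
    (Submodule.fg_span ((Set.finite_range X).insert 1)).pow r
  obtain ⟨M, θ, hθ⟩ := Submodule.fg_iff_exists_fin_generating_family.1 hfg
  refine ⟨M, θ, fun s hs g => ?_⟩
  have hsep : ∀ z₀ z : ι → ℝ, ∃ f ∈ W, z ≠ z₀ → f z = 0 ∧ f z₀ = 1 := by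
    intro z₀ z
    by_cases h : z = z₀
    · exact ⟨1, hW1, fun h' => absurd h h'⟩
    · obtain ⟨i, hi⟩ := Function.ne_iff.1 h
      refine ⟨(z₀ i - z i)⁻¹ • (X i - z i • 1),
        W.smul_mem _ (W.sub_mem (hWX i) (W.smul_mem _ hW1)), fun _ => ⟨by simp [X], ?_⟩⟩
      have : z₀ i - z i ≠ 0 := sub_ne_zero.2 (Ne.symm hi)
      simp [X, this]
  choose f hfW hf using hsep
  have hprod : ∀ (z₀ : ι → ℝ) (t : Finset (ι → ℝ)), ∏ z ∈ t, f z₀ z ∈ W ^ t.card := by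
    intro z₀ t
    induction t using Finset.induction_on with
    | empty => simp
    | insert a t ha ih =>
      rw [Finset.prod_insert ha, Finset.card_insert_of_notMem ha, pow_succ']
      exact Submodule.mul_mem_mul (hfW _ _) ih
  have hL : ∑ z₀ ∈ s, g z₀ • ∏ z ∈ s.erase z₀, f z₀ z ∈ W ^ r := by
    refine Submodule.sum_mem _ fun z₀ _ => Submodule.smul_mem _ _ ?_
    exact pow_le_pow_right' (Submodule.one_le.2 hW1)
      ((Finset.card_le_card (Finset.erase_subset _ _)).trans hs) (hprod z₀ _)
  rw [← hθ] at hL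
  obtain ⟨c, hc⟩ := (Submodule.mem_span_range_iff_exists_fun ℝ).1 hL
  refine ⟨c, fun z hz => ?_⟩
  have h1 := congrArg (fun F : C(ι → ℝ, ℝ) => F z) hc
  simp only [ContinuousMap.sum_apply, ContinuousMap.smul_apply, ContinuousMap.prod_apply,
    smul_eq_mul] at h1
  rw [h1, Finset.sum_eq_single z]
  · rw [Finset.prod_eq_one, mul_one]
    intro z' hz'
    exact (hf z z' (Finset.ne_of_mem_erase hz')).2
  · intro z₀ _ hne
    rw [Finset.prod_eq_zero (f := fun i => f z₀ i z) (Finset.mem_erase.2 ⟨Ne.symm hne, hz⟩)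
      (hf z₀ z (Ne.symm hne)).1, mul_zero]
  · exact fun h => absurd hz h

/-- Two finitely supported signed measures with `n` distinct atoms each and with the same integrals
agree up to a relabelling of the atoms, provided that the weights of the first do not vanish. -/
theorem exists_perm_of_forall_sum_eq {E : Type*} {n : ℕ} {a a' : Fin n → E} {w w' : Fin n → ℝ}
    (ha : Function.Injective a) (ha' : Function.Injective a') (hw : ∀ i, w i ≠ 0)
    (h : ∀ g : E → ℝ, ∑ i, w i * g (a i) = ∑ i, w' i * g (a' i)) :
    ∃ π : Equiv.Perm (Fin n), ∀ i, a' (π i) = a i ∧ w' (π i) = w i := by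
  classical
  have key : ∀ i, ∃ i', a' i' = a i ∧ w' i' = w i := by
    intro i
    have hi := h fun z => if z = a i then 1 else 0
    have hl : ∑ k, w k * (if a k = a i then 1 else 0) = w i := by
      rw [Finset.sum_eq_single i (fun k _ hk => by simp [ha.ne hk]) (by simp)]
      simp
    rw [hl] at hi
    obtain ⟨i', _, hi'⟩ := Finset.exists_ne_zero_of_sum_ne_zero (hi ▸ hw i)
    have hii : a' i' = a i := by
      by_contra hne
      simp [hne] at hi'
    refine ⟨i', hii, ?_⟩
    rw [hi, Finset.sum_eq_single i' (fun k _ hk => by simp [← hii, ha'.ne hk]) (by simp)]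
    simp [hii]
  choose π hπ using key
  have hinj : Function.Injective π := fun i k hik => ha (by rw [← (hπ i).1, ← (hπ k).1, hik])
  exact ⟨Equiv.ofBijective π (Finite.injective_iff_bijective.1 hinj), hπ⟩

/-- Finitely many generalised moments determine a signed measure with `n` distinct atoms and
nonzero weights, up to a relabelling of the atoms. -/
theorem exists_moments (ι : Type*) [Finite ι] (n : ℕ) :
    ∃ (M : ℕ) (θ : Fin M → C(ι → ℝ, ℝ)), ∀ (a a' : Fin n → ι → ℝ) (w w' : Fin n → ℝ),
      Function.Injective a → Function.Injective a' → (∀ i, w i ≠ 0) →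
      (∀ k, ∑ i, w i * θ k (a i) = ∑ i, w' i * θ k (a' i)) →
      ∃ π : Equiv.Perm (Fin n), ∀ i, a' (π i) = a i ∧ w' (π i) = w i := by
  classical
  obtain ⟨M, θ, hθ⟩ := exists_interpolating_family ι (n + n)
  refine ⟨M, θ, fun a a' w w' ha ha' hw h => exists_perm_of_forall_sum_eq ha ha' hw fun g => ?_⟩
  obtain ⟨c, hc⟩ := hθ (Finset.univ.image a ∪ Finset.univ.image a')
    ((Finset.card_union_le _ _).trans (add_le_add
      (Finset.card_image_le.trans (by simp)) (Finset.card_image_le.trans (by simp)))) g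
  have hswap : ∀ (v : Fin n → ℝ) (b : Fin n → ι → ℝ),
      ∑ i, v i * ∑ k, c k * θ k (b i) = ∑ k, c k * ∑ i, v i * θ k (b i) := by
    intro v b
    simp only [Finset.mul_sum]
    rw [Finset.sum_comm]
    exact Finset.sum_congr rfl fun k _ => Finset.sum_congr rfl fun i _ => by ring
  calc ∑ i, w i * g (a i) = ∑ i, w i * ∑ k, c k * θ k (a i) :=
        Finset.sum_congr rfl fun i _ => by rw [hc (a i) (by simp)]
    _ = ∑ i, w' i * ∑ k, c k * θ k (a' i) := by simp only [hswap, h]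
    _ = ∑ i, w' i * g (a' i) :=
        Finset.sum_congr rfl fun i _ => by rw [hc (a' i) (by simp)]

/-! ### Two iterations with continuous processors -/

/-- The inputs at which the detection problem with constellation `C` is nondegenerate: the entries
of the channel matrix are nonzero, those of each row are distinct, those of the received vector are
distinct, and different transmit vectors have different residuals. -/
structure IsGeneric {N K : ℕ} (C : Finset ℝ) (p : ChannelData N K) : Prop where
  ne_zero : ∀ i j, p.1 i j ≠ 0
  row_injective : ∀ i, Function.Injective (p.1 i)
  rx_injective : Function.Injective p.2
  sqResidual_ne : ∀ x x' : Fin K → ℝ, (∀ j, x j ∈ C) → (∀ j, x' j ∈ C) → x ≠ x' →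
    sqResidual p x ≠ sqResidual p x'

open ChannelNetMLP in
/-- The transmit features after two iterations with receive processors `φIn`, `φ` and transmit
processor `ψ`, which may be arbitrary functions. -/
def twoStepFeature {N K d : ℕ} (φIn : (Fin 1 → ℝ) → Fin d → ℝ) (ψ φ : (Fin d → ℝ) → Fin d → ℝ)
    (p : ChannelData N K) : Fin K → Fin d → ℝ :=
  toTx p (fun i => φ (toRx p (fun j => ψ (toTx p (fun i => φIn fun _ => p.2 i) j)) i)) +
    toTx p (fun i => φIn fun _ => p.2 i)

/-- With suitable continuous processors, the transmit features after two iterations determine a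
generic input and the antenna at which they are taken, up to a relabelling of the antennas. The
first round collects moments of the entries of a column, labelled by the entries of the received
vector; thus a transmit antenna knows its column. The second round collects at each receive antenna
moments of the entries of its row, labelled by the columns, and passes moments of all this back to
the transmit antennas. -/
theorem exists_twoStepFeature_separating (N K : ℕ) (hN : 0 < N) :
    ∃ (d : ℕ) (φIn : C(Fin 1 → ℝ, Fin d → ℝ)) (ψ φ : C(Fin d → ℝ, Fin d → ℝ)),
      ∀ (C : Finset ℝ) (p p' : ChannelData N K), IsGeneric C p → IsGeneric C p' →
      ∀ j j', twoStepFeature φIn ψ φ p j = twoStepFeature φIn ψ φ p' j' →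
      ∃ (π : Equiv.Perm (Fin N)) (τ : Equiv.Perm (Fin K)), τ j = j' ∧
        (∀ i, p'.2 (π i) = p.2 i) ∧ ∀ i k, p'.1 (π i) (τ k) = p.1 i k := by
  obtain ⟨M₁, θ₁, h₁⟩ := exists_moments (Fin 1) N
  obtain ⟨M₂, θ₂, h₂⟩ := exists_moments (Fin M₁) K
  obtain ⟨M₃, θ₃, h₃⟩ := exists_moments (Unit ⊕ Fin M₂) N
  -- Three blocks of feature coordinates, written to by `φIn`, `ψ` and `φ`. The `Unit` coordinate is
  -- left at zero by `ψ`, so that the subtraction of the received vector shows its entry there.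
  let e := Fintype.equivFin (Fin M₁ ⊕ (Unit ⊕ Fin M₂) ⊕ Fin M₃)
  let φIn : C(Fin 1 → ℝ, Fin _ → ℝ) := ContinuousMap.pi fun q =>
    Sum.elim (fun k => θ₁ k) (fun _ => 0) (e.symm q)
  let ψ : C(Fin _ → ℝ, Fin _ → ℝ) := ContinuousMap.pi fun q =>
    Sum.elim (fun _ => 0) (Sum.elim (Sum.elim (fun _ => 0)
      (fun k => (θ₂ k).comp ⟨fun G r => G (e (Sum.inl r)), by fun_prop⟩)) (fun _ => 0)) (e.symm q)
  let φ : C(Fin _ → ℝ, Fin _ → ℝ) := ContinuousMap.pi fun q =>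
    Sum.elim (fun _ => 0) (Sum.elim (fun _ => 0)
      (fun k => (θ₃ k).comp ⟨fun R u => R (e (Sum.inr (Sum.inl u))), by fun_prop⟩)) (e.symm q)
  refine ⟨_, φIn, ψ, φ, fun C p p' hp hp' j j' hfeat => ?_⟩
  let code : ChannelData N K → Fin K → Fin M₁ → ℝ :=
    fun p j k => ∑ i, p.1 i j * θ₁ k (fun _ => p.2 i)
  let rx : ChannelData N K → Fin N → Unit ⊕ Fin M₂ → ℝ := fun p i =>
    Sum.elim (fun _ => -p.2 i) (fun k => ∑ j, p.1 i j * θ₂ k (code p j) - p.2 i)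
  have hfeat' : ∀ k, ∑ i, p.1 i j * θ₃ k (rx p i) = ∑ i, p'.1 i j' * θ₃ k (rx p' i) := by
    have hcoord : ∀ (p : ChannelData N K) j k,
        twoStepFeature φIn ψ φ p j (e (Sum.inr (Sum.inr k))) = ∑ i, p.1 i j * θ₃ k (rx p i) := by
      intro p j k
      have hrx : ∀ i, rx p i = fun u => ∑ l, p.1 i l * ψ (fun a => ∑ i, p.1 i l *
          φIn (fun _ => p.2 i) a) (e (Sum.inr (Sum.inl u))) - p.2 i := by
        intro i
        ext u
        cases u <;> simp [rx, ψ, φIn, code]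
      simp only [twoStepFeature, ChannelNetMLP.toTx, Pi.add_apply, hrx]
      simp [φ, φIn]
      rfl
    intro k
    rw [← hcoord, ← hcoord, hfeat]
  have hy : ∀ p : ChannelData N K, IsGeneric C p →
      Function.Injective fun i => (fun _ => p.2 i : Fin 1 → ℝ) := fun p hp i i' h =>
    hp.rx_injective (congrFun h 0)
  have hrx_inj : ∀ p : ChannelData N K, IsGeneric C p → Function.Injective (rx p) :=
    fun p hp i i' h => hp.rx_injective (by simpa [rx] using congrFun h (Sum.inl ()))
  have hcode_inj : ∀ p : ChannelData N K, IsGeneric C p → Function.Injective (code p) := by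
    intro p hp l l' h
    obtain ⟨ρ, hρ⟩ := h₁ _ _ (fun i => p.1 i l) (fun i => p.1 i l') (hy p hp) (hy p hp)
      (fun i => hp.ne_zero i l) (fun k => congrFun h k)
    have hρ1 : ρ ⟨0, hN⟩ = ⟨0, hN⟩ := hy p hp (hρ _).1
    have := (hρ ⟨0, hN⟩).2
    rw [hρ1] at this
    exact (hp.row_injective _ this).symm
  obtain ⟨π, hπ⟩ := h₃ _ _ (fun i => p.1 i j) (fun i => p'.1 i j') (hrx_inj p hp)
    (hrx_inj p' hp') (fun i => hp.ne_zero i j) hfeat'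
  have hπy : ∀ i, p'.2 (π i) = p.2 i := fun i => by
    simpa [rx] using congrFun (hπ i).1 (Sum.inl ())
  have hrow : ∀ i, ∃ τ : Equiv.Perm (Fin K), ∀ k, code p' (τ k) = code p k ∧
      p'.1 (π i) (τ k) = p.1 i k := by
    intro i
    refine h₂ _ _ (p.1 i) (p'.1 (π i)) (hcode_inj p hp) (hcode_inj p' hp') (hp.ne_zero i) ?_
    intro k
    have := congrFun (hπ i).1 (Sum.inr k)
    simp only [rx, Sum.elim_inr, hπy] at this
    linarith
  choose τ hτ using hrow
  -- The relabelling of the columns is the same for all rows, as the columns have distinct codes.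
  have hτ0 : ∀ i, τ i = τ ⟨0, hN⟩ := fun i => Equiv.ext fun k =>
    hcode_inj p' hp' ((hτ i k).1.trans (hτ ⟨0, hN⟩ k).1.symm)
  refine ⟨π, τ ⟨0, hN⟩, ?_, hπy, fun i k => by rw [← hτ0 i]; exact (hτ i k).2⟩
  exact hp'.row_injective (π ⟨0, hN⟩) ((hτ ⟨0, hN⟩ j).2.trans (hπ ⟨0, hN⟩).2.symm)

/-! ### Equivariance of maximum-likelihood detectors -/

theorem sqResidual_comp_perm {N K : ℕ} {p p' : ChannelData N K} {π : Equiv.Perm (Fin N)}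
    {τ : Equiv.Perm (Fin K)} (hy : ∀ i, p'.2 (π i) = p.2 i)
    (hH : ∀ i k, p'.1 (π i) (τ k) = p.1 i k) (x : Fin K → ℝ) :
    sqResidual p (x ∘ τ) = sqResidual p' x := by
  unfold sqResidual
  symm
  rw [← Equiv.sum_comp π]
  refine Finset.sum_congr rfl fun i _ => ?_
  rw [hy, ← Equiv.sum_comp τ]
  simp [hH]

theorem IsMLDetector.eq_of_forall_sqResidual_le {N K : ℕ} {C : Finset ℝ}
    {g : ChannelData N K → EuclideanSpace ℝ (Fin K)} (hg : IsMLDetector C g)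
    {p : ChannelData N K} (hp : IsGeneric C p) {x : Fin K → ℝ} (hx : ∀ j, x j ∈ C)
    (hmin : ∀ x' : Fin K → ℝ, (∀ j, x' j ∈ C) → sqResidual p x ≤ sqResidual p x') (j : Fin K) :
    g p j = x j := by
  by_contra hne
  have : (fun j => g p j) ≠ x := fun h => hne (congrFun h j)
  exact hp.sqResidual_ne _ _ (hg p).1 hx this
    (le_antisymm ((hg p).2 x hx) (hmin _ (hg p).1))

/-- At generic inputs a maximum-likelihood detector is equivariant under relabellings of the
antennas. -/
theorem IsMLDetector.apply_eq_of_perm {N K : ℕ} {C : Finset ℝ}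
    {g : ChannelData N K → EuclideanSpace ℝ (Fin K)} (hg : IsMLDetector C g)
    {p p' : ChannelData N K} (hp : IsGeneric C p) {π : Equiv.Perm (Fin N)}
    {τ : Equiv.Perm (Fin K)} (hy : ∀ i, p'.2 (π i) = p.2 i)
    (hH : ∀ i k, p'.1 (π i) (τ k) = p.1 i k) (j : Fin K) : g p j = g p' (τ j) := by
  refine hg.eq_of_forall_sqResidual_le hp (x := (fun k => g p' k) ∘ τ)
    (fun k => (hg p').1 (τ k)) (fun x' hx' => ?_) j
  rw [sqResidual_comp_perm hy hH]
  have hx : x' = (x' ∘ τ.symm) ∘ τ := by ext k; simp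
  rw [hx, sqResidual_comp_perm hy hH]
  exact (hg p').2 _ fun k => hx' _

/-! ### Generic inputs form an open set of full measure -/

/-- A continuous function that restricts to a polynomial of degree two on every line of some fixed
direction is almost everywhere nonzero. -/
theorem ae_ne_zero_of_quadratic_on_lines {V : Type*} [NormedAddCommGroup V] [NormedSpace ℝ V]
    [FiniteDimensional ℝ V] [MeasurableSpace V] [BorelSpace V] (μ : Measure V)
    [μ.IsAddHaarMeasure] {f : V → ℝ} (hf : Continuous f) (w : V) (c : ℝ) (hc : c ≠ 0)
    (h : ∀ v, ∃ a b : ℝ, ∀ t : ℝ, f (v + t • w) = a + t * b + t ^ 2 * c) :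
    ∀ᵐ v ∂μ, f v ≠ 0 := by
  have : ProperSpace V := FiniteDimensional.proper ℝ V
  refine ae_mem_of_ae_add_linearMap_mem (LinearMap.toSpanSingleton ℝ V w) volume μ
    (s := {v | f v ≠ 0}) (isOpen_ne_fun hf continuous_const).measurableSet fun v => ?_
  obtain ⟨a, b, hab⟩ := h v
  let q : Polynomial ℝ := Polynomial.C c * Polynomial.X ^ 2 + Polynomial.C b * Polynomial.X
    + Polynomial.C a
  have hq : q ≠ 0 := by
    intro h0
    have := congrArg (fun r => Polynomial.coeff r 2) h0
    simp [q] at this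
    exact hc this
  have hfin : {t : ℝ | q.IsRoot t}.Finite := Polynomial.finite_setOfPred_isRoot hq
  filter_upwards [hfin.countable.ae_notMem volume] with t ht h0
  apply ht
  simp only [LinearMap.toSpanSingleton_apply] at h0
  rw [hab] at h0
  simp [q]
  linarith

theorem continuous_sqResidual {N K : ℕ} (x : Fin K → ℝ) :
    Continuous fun p : ChannelData N K => sqResidual p x := by
  unfold sqResidual
  fun_prop

theorem sqResidual_add_smul {N K : ℕ} (p w : ChannelData N K) (x : Fin K → ℝ) (t : ℝ) :
    sqResidual (p + t • w) x = sqResidual p x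
      + t * ∑ i, 2 * (p.2 i - ∑ j, p.1 i j * x j) * (w.2 i - ∑ j, w.1 i j * x j)
      + t ^ 2 * sqResidual w x := by
  simp only [sqResidual, Finset.mul_sum, ← Finset.sum_add_distrib]
  refine Finset.sum_congr rfl fun i _ => ?_
  have : ∑ j, (p + t • w).1 i j * x j = ∑ j, p.1 i j * x j + t * ∑ j, w.1 i j * x j := by
    simp only [Finset.mul_sum, ← Finset.sum_add_distrib]
    refine Finset.sum_congr rfl fun j _ => ?_
    simp
    ring
  rw [this]
  simp only [Prod.snd_add, Prod.smul_snd, Pi.add_apply, Pi.smul_apply, smul_eq_mul]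
  ring

theorem isOpen_isGeneric {N K : ℕ} (C : Finset ℝ) :
    IsOpen {p : ChannelData N K | IsGeneric C p} := by
  have hC : {x : Fin K → ℝ | ∀ j, x j ∈ C}.Finite := by
    have := Set.Finite.pi fun _ : Fin K => C.finite_toSet
    simpa [Set.pi] using this
  have heq : {p : ChannelData N K | IsGeneric C p} =
      (⋂ i, ⋂ j, {p | p.1 i j ≠ 0}) ∩
      (⋂ i, ⋂ j, ⋂ j', ⋂ _ : j ≠ j', {p | p.1 i j ≠ p.1 i j'}) ∩
      (⋂ i, ⋂ i', ⋂ _ : i ≠ i', {p | p.2 i ≠ p.2 i'}) ∩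
      (⋂ x ∈ {x : Fin K → ℝ | ∀ j, x j ∈ C}, ⋂ x' ∈ {x : Fin K → ℝ | ∀ j, x j ∈ C},
        ⋂ _ : x ≠ x', {p | sqResidual p x ≠ sqResidual p x'}) := by
    ext p
    simp only [Set.mem_inter_iff, Set.mem_iInter, Set.mem_ofPred_eq]
    constructor
    · intro h
      exact ⟨⟨⟨h.ne_zero, fun i j j' hj => (h.row_injective i).ne hj⟩,
        fun i i' hi => h.rx_injective.ne hi⟩, fun x hx x' hx' hne => h.sqResidual_ne x x' hx hx' hne⟩
    · rintro ⟨⟨⟨h1, h2⟩, h3⟩, h4⟩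
      exact ⟨h1, fun i j j' => not_imp_not.1 (h2 i j j'), fun i i' => not_imp_not.1 (h3 i i'),
        fun x x' hx hx' hne => h4 x hx x' hx' hne⟩
  rw [heq]
  refine ((IsOpen.inter ?_ ?_).inter ?_).inter ?_
  · exact isOpen_iInter_of_finite fun i => isOpen_iInter_of_finite fun j =>
      isOpen_ne_fun (by fun_prop) (by fun_prop)
  · exact isOpen_iInter_of_finite fun i => isOpen_iInter_of_finite fun j =>
      isOpen_iInter_of_finite fun j' => isOpen_iInter_of_finite fun _ =>
      isOpen_ne_fun (by fun_prop) (by fun_prop)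
  · exact isOpen_iInter_of_finite fun i => isOpen_iInter_of_finite fun i' =>
      isOpen_iInter_of_finite fun _ => isOpen_ne_fun (by fun_prop) (by fun_prop)
  · exact hC.isOpen_biInter fun x _ => hC.isOpen_biInter fun x' _ =>
      isOpen_iInter_of_finite fun _ =>
        isOpen_ne_fun (continuous_sqResidual x) (continuous_sqResidual x')

/-- Almost all points of a parameter space `V` have a generic image under a linear map `R`, provided
that no nonzero vector is orthogonal to the `i`-th rows of all its channel matrices, for any `i`, and
that the received vector can be prescribed independently of the channel matrix. The conditions are
the nonvanishing of finitely many linear and quadratic forms, and it is enough to find for each of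
them one point at which it does not vanish. -/
theorem ae_isGeneric_comp {N K : ℕ} {V : Type*} [NormedAddCommGroup V] [NormedSpace ℝ V]
    [FiniteDimensional ℝ V] [MeasurableSpace V] [BorelSpace V] (μ : Measure V)
    [μ.IsAddHaarMeasure] (hN : 0 < N) (C : Finset ℝ) (R : V →ₗ[ℝ] ChannelData N K)
    (hrow : ∀ (u : Fin K → ℝ), u ≠ 0 → ∀ i, ∃ v, (R v).1 i ⬝ᵥ u ≠ 0)
    (hrx : ∀ v y, ∃ v', (R v').1 = (R v).1 ∧ (R v').2 = y) :
    ∀ᵐ v ∂μ, IsGeneric C (R v) := by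
  have hR : Continuous R := R.continuous_of_finiteDimensional
  have hlin : ∀ l : ChannelData N K →ₗ[ℝ] ℝ, (∃ v, l (R v) ≠ 0) → ∀ᵐ v ∂μ, l (R v) ≠ 0 := by
    rintro l ⟨w, hw⟩
    have hl : Continuous l := l.continuous_of_finiteDimensional
    have := ae_ne_zero_of_quadratic_on_lines μ (f := fun v => l (R v) ^ 2) (by fun_prop) w
      (l (R w) ^ 2) (pow_ne_zero 2 hw) fun v =>
        ⟨l (R v) ^ 2, 2 * l (R v) * l (R w), fun t => by simp; ring⟩
    filter_upwards [this] with v hv h0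
    simp [h0] at hv
  have hrow' : ∀ (u : Fin K → ℝ), u ≠ 0 → ∀ i, ∀ᵐ v ∂μ, (R v).1 i ⬝ᵥ u ≠ 0 := by
    intro u hu i
    let l : ChannelData N K →ₗ[ℝ] ℝ :=
      { toFun := fun p => p.1 i ⬝ᵥ u
        map_add' := fun p q => by simp [add_dotProduct]
        map_smul' := fun a p => by simp [smul_dotProduct] }
    exact hlin l (hrow u hu i)
  have h1 : ∀ᵐ v ∂μ, ∀ i j, (R v).1 i j ≠ 0 := by
    refine ae_all_iff.2 fun i => ae_all_iff.2 fun j => ?_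
    simpa using hrow' (Pi.single j 1) (by simp) i
  have h2 : ∀ᵐ v ∂μ, ∀ i j j', j ≠ j' → (R v).1 i j ≠ (R v).1 i j' := by
    refine ae_all_iff.2 fun i => ae_all_iff.2 fun j => ae_all_iff.2 fun j' => ?_
    by_cases hj : j = j'
    · simp [hj]
    have hne : (Pi.single j 1 - Pi.single j' 1 : Fin K → ℝ) ≠ 0 := fun h => by
      simpa [hj] using congrFun h j
    filter_upwards [hrow' _ hne i] with v hv _
    simpa [dotProduct_sub, sub_eq_zero] using hv
  have h3 : ∀ᵐ v ∂μ, ∀ i i', i ≠ i' → (R v).2 i ≠ (R v).2 i' := by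
    refine ae_all_iff.2 fun i => ae_all_iff.2 fun i' => ?_
    by_cases hi : i = i'
    · simp [hi]
    obtain ⟨w, -, hw⟩ := hrx 0 (Pi.single i 1)
    let l : ChannelData N K →ₗ[ℝ] ℝ :=
      { toFun := fun p => p.2 i - p.2 i'
        map_add' := fun p q => by simp; ring
        map_smul' := fun a p => by simp; ring }
    have := hlin l ⟨w, by simp [l, hw, Ne.symm hi]⟩
    filter_upwards [this] with v hv _
    simpa [l, sub_eq_zero] using hv
  have hC : {x : Fin K → ℝ | ∀ j, x j ∈ C}.Countable := by
    have := Set.Finite.pi fun _ : Fin K => C.finite_toSet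
    exact Set.Finite.countable (by simpa [Set.pi] using this)
  have h4 : ∀ᵐ v ∂μ, ∀ x ∈ {x : Fin K → ℝ | ∀ j, x j ∈ C},
      ∀ x' ∈ {x : Fin K → ℝ | ∀ j, x j ∈ C}, x ≠ x' →
      sqResidual (R v) x ≠ sqResidual (R v) x' := by
    refine (ae_ball_iff hC).2 fun x _ => (ae_ball_iff hC).2 fun x' _ => ?_
    by_cases hx : x = x'
    · simp [hx]
    obtain ⟨v₀, hv₀⟩ := hrow (x - x') (sub_ne_zero.2 hx) ⟨0, hN⟩
    -- A channel that tells `x` from `x'`, together with the noiseless reception of `x'`.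
    obtain ⟨w, hw1, hw2⟩ := hrx v₀ fun i => ∑ j, (R v₀).1 i j * x' j
    have hc : sqResidual (R w) x - sqResidual (R w) x' ≠ 0 := by
      have h0 : sqResidual (R w) x' = 0 := by simp [sqResidual, hw1, hw2]
      rw [h0, sub_zero]
      intro h
      have h := (Finset.sum_eq_zero_iff_of_nonneg fun i _ => sq_nonneg _).1 h ⟨0, hN⟩
        (Finset.mem_univ _)
      apply hv₀
      rw [hw1, hw2, sq_eq_zero_iff, sub_eq_zero] at h
      rw [dotProduct_sub, sub_eq_zero]
      exact h.symm
    have := ae_ne_zero_of_quadratic_on_lines μ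
      (f := fun v => sqResidual (R v) x - sqResidual (R v) x')
      (((continuous_sqResidual x).comp hR).sub ((continuous_sqResidual x').comp hR)) w _ hc
      fun v => ⟨sqResidual (R v) x - sqResidual (R v) x', _, fun t => by
        rw [map_add, map_smul, sqResidual_add_smul, sqResidual_add_smul]
        rw [add_sub_add_comm, add_sub_add_comm, ← mul_sub, ← mul_sub]⟩
    filter_upwards [this] with v hv _ h
    exact hv (sub_eq_zero.2 h)
  filter_upwards [h1, h2, h3, h4] with v h1 h2 h3 h4
  exact ⟨h1, fun i j j' => not_imp_not.1 (h2 i j j'), fun i i' => not_imp_not.1 (h3 i i'),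
    fun x x' hx hx' hne => h4 x hx x' hx' hne⟩

/-! ### The real representation of a complex channel -/

section RealRepresentation

variable {Nr Nt N K : ℕ} (eN : Fin Nr ⊕ Fin Nr ≃ Fin N) (eK : Fin Nt ⊕ Fin Nt ≃ Fin K)
  (q : (Fin Nr → Fin Nt → ℂ) × (Fin Nr → ℂ)) (r : Fin Nr) (k : Fin Nt)

theorem realRepr_fst_inl_inl :
    (realRepr eN eK q).1 (eN (Sum.inl r)) (eK (Sum.inl k)) = (q.1 r k).re := by
  simp only [realRepr, Equiv.symm_apply_apply]; rfl

theorem realRepr_fst_inl_inr :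
    (realRepr eN eK q).1 (eN (Sum.inl r)) (eK (Sum.inr k)) = -(q.1 r k).im := by
  simp only [realRepr, Equiv.symm_apply_apply]; rfl

theorem realRepr_fst_inr_inl :
    (realRepr eN eK q).1 (eN (Sum.inr r)) (eK (Sum.inl k)) = (q.1 r k).im := by
  simp only [realRepr, Equiv.symm_apply_apply]; rfl

theorem realRepr_fst_inr_inr :
    (realRepr eN eK q).1 (eN (Sum.inr r)) (eK (Sum.inr k)) = (q.1 r k).re := by
  simp only [realRepr, Equiv.symm_apply_apply]; rfl

theorem realRepr_snd_inl : (realRepr eN eK q).2 (eN (Sum.inl r)) = (q.2 r).re := by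
  simp [realRepr]

theorem realRepr_snd_inr : (realRepr eN eK q).2 (eN (Sum.inr r)) = (q.2 r).im := by
  simp [realRepr]

/-- `realRepr` as a real linear map. -/
noncomputable def realReprₗ :
    ((Fin Nr → Fin Nt → ℂ) × (Fin Nr → ℂ)) →ₗ[ℝ] ChannelData N K where
  toFun := realRepr eN eK
  map_add' p q := by
    refine Prod.ext (funext fun i => funext fun j => ?_) (funext fun i => ?_) <;>
      obtain ⟨i, rfl⟩ := eN.surjective i
    · obtain ⟨j, rfl⟩ := eK.surjective j
      rcases i with r | r <;> rcases j with k | k <;>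
        simp [realRepr_fst_inl_inl, realRepr_fst_inl_inr, realRepr_fst_inr_inl,
          realRepr_fst_inr_inr, add_comm]
    · rcases i with r | r <;> simp [realRepr_snd_inl, realRepr_snd_inr]
  map_smul' a p := by
    refine Prod.ext (funext fun i => funext fun j => ?_) (funext fun i => ?_) <;>
      obtain ⟨i, rfl⟩ := eN.surjective i
    · obtain ⟨j, rfl⟩ := eK.surjective j
      rcases i with r | r <;> rcases j with k | k <;>
        simp [realRepr_fst_inl_inl, realRepr_fst_inl_inr, realRepr_fst_inr_inl,
          realRepr_fst_inr_inr]
    · rcases i with r | r <;> simp [realRepr_snd_inl, realRepr_snd_inr]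

/-- Any single row of the real representation can be prescribed. -/
theorem exists_realRepr_row_eq (u : Fin K → ℝ) (i : Fin N) :
    ∃ q, (realRepr eN eK q).1 i = u := by
  obtain ⟨i, rfl⟩ := eN.surjective i
  rcases i with r | r
  · refine ⟨(fun _ k => ⟨u (eK (Sum.inl k)), -u (eK (Sum.inr k))⟩, 0), funext fun j => ?_⟩
    obtain ⟨j, rfl⟩ := eK.surjective j
    rcases j with k | k <;> simp [realRepr_fst_inl_inl, realRepr_fst_inl_inr]
  · refine ⟨(fun _ k => ⟨u (eK (Sum.inr k)), u (eK (Sum.inl k))⟩, 0), funext fun j => ?_⟩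
    obtain ⟨j, rfl⟩ := eK.surjective j
    rcases j with k | k <;> simp [realRepr_fst_inr_inl, realRepr_fst_inr_inr]

theorem exists_realRepr_snd_eq (y : Fin N → ℝ) :
    ∃ q', (realRepr eN eK q').1 = (realRepr eN eK q).1 ∧ (realRepr eN eK q').2 = y := by
  refine ⟨(q.1, fun r => ⟨y (eN (Sum.inl r)), y (eN (Sum.inr r))⟩), rfl, funext fun i => ?_⟩
  obtain ⟨i, rfl⟩ := eN.surjective i
  rcases i with r | r <;> simp [realRepr_snd_inl, realRepr_snd_inr]

end RealRepresentation

-- The nested products of measure spaces need a larger search than the default.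
set_option synthInstance.maxSize 1000 in
theorem HasContinuousDistribution.ae_isGeneric {N K : ℕ} (hN : 0 < N) (C : Finset ℝ)
    {P : Measure (ChannelData N K)} (hP : HasContinuousDistribution P) :
    ∀ᵐ p ∂P, IsGeneric C p := by
  rcases hP with hP | ⟨Nr, Nt, eN, eK, hP⟩
  · have : (volume : Measure (ChannelData N K)).IsAddHaarMeasure :=
      Measure.prod.instIsAddHaarMeasure _ _
    refine hP.ae_le (ae_isGeneric_comp volume hN C LinearMap.id (fun u hu i => ?_)
      fun v y => ⟨(v.1, y), rfl, rfl⟩)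
    exact ⟨(fun _ => u, 0), dotProduct_self_eq_zero.not.2 hu⟩
  · have : (volume : Measure ((Fin Nr → Fin Nt → ℂ) × (Fin Nr → ℂ))).IsAddHaarMeasure :=
      Measure.prod.instIsAddHaarMeasure _ _
    refine hP.ae_le ?_
    change ∀ᵐ p ∂Measure.map (realRepr eN eK) volume, IsGeneric C p
    have hm : Measurable (realRepr eN eK) :=
      (realReprₗ eN eK).continuous_of_finiteDimensional.measurable
    rw [ae_map_iff hm.aemeasurable (isOpen_isGeneric C).measurableSet]
    exact ae_isGeneric_comp volume hN C (realReprₗ eN eK)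
      (fun u hu i => by
        obtain ⟨q, hq⟩ := exists_realRepr_row_eq eN eK u i
        exact ⟨q, by
          change (realRepr eN eK q).1 i ⬝ᵥ u ≠ 0
          rw [hq]
          exact dotProduct_self_eq_zero.not.2 hu⟩) (exists_realRepr_snd_eq eN eK)

/-! ### Approximation of the detector -/

/-- A maximum-likelihood detector is locally constant near generic inputs. -/
theorem IsMLDetector.continuousAt {N K : ℕ} {C : Finset ℝ}
    {g : ChannelData N K → EuclideanSpace ℝ (Fin K)} (hg : IsMLDetector C g)
    {p : ChannelData N K} (hp : IsGeneric C p) : ContinuousAt g p := by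
  have hC : {x : Fin K → ℝ | ∀ j, x j ∈ C}.Finite := by
    have := Set.Finite.pi fun _ : Fin K => C.finite_toSet
    simpa [Set.pi] using this
  have hev : ∀ᶠ p' in nhds p, ∀ x ∈ {x : Fin K → ℝ | ∀ j, x j ∈ C}, x ≠ (fun j => g p j) →
      sqResidual p' (fun j => g p j) < sqResidual p' x := by
    refine (Filter.eventually_all_finite hC).2 fun x hx => ?_
    by_cases hne : x = fun j => g p j
    · simp [hne]
    have hlt : sqResidual p (fun j => g p j) < sqResidual p x :=
      lt_of_le_of_ne ((hg p).2 x hx) (hp.sqResidual_ne _ _ (hg p).1 hx (Ne.symm hne))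
    filter_upwards [(continuous_sqResidual (fun j => g p j)).continuousAt.eventually_lt
      (continuous_sqResidual x).continuousAt hlt] with p' hp' _ using hp'
  have heq : ∀ᶠ p' in nhds p, g p = g p' := by
    filter_upwards [hev] with p' hp'
    by_contra hne
    refine absurd ((hg p').2 (fun j => g p j) (hg p).1) (not_le.2 (hp' _ (hg p').1 fun h => hne ?_))
    ext j
    exact (congrFun h j).symm
  exact continuousAt_const.congr heq

/-- A continuous function on a compact space that is constant on the fibres of a continuous map `G`
to a Euclidean space factors through `G`. -/
theorem exists_continuousMap_comp_eq {S : Type*} [TopologicalSpace S] [CompactSpace S] {d : ℕ}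
    (G : C(S, Fin d → ℝ)) (F : C(S, ℝ)) (h : ∀ s s', G s = G s' → F s = F s') :
    ∃ c : C(Fin d → ℝ, ℝ), ∀ s, c (G s) = F s := by
  let G' : C(S, Set.range G) := ⟨Set.rangeFactorization G, by fun_prop⟩
  have hq : Topology.IsQuotientMap G' :=
    G'.continuous.isClosedMap.isQuotientMap G'.continuous Set.rangeFactorization_surjective
  have hF : Function.FactorsThrough F G' := fun s s' hs => h s s' (congrArg Subtype.val hs)
  let c₀ : C(Set.range G, ℝ) := hq.lift F hF
  obtain ⟨c, hc⟩ := c₀.exists_restrict_eq (isCompact_range G.continuous).isClosed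
  refine ⟨c, fun s => ?_⟩
  have h1 : c (G s) = c₀ (G' s) := by rw [← hc]; rfl
  rw [h1]
  exact congrArg (fun f : C(S, ℝ) => f s) (hq.lift_comp F hF)

/-- The processors of a two-iteration network, as arbitrary continuous maps. -/
abbrev ContinuousProcessors (d : ℕ) : Type :=
  C(Fin 1 → ℝ, Fin d → ℝ) × C(Fin d → ℝ, Fin d → ℝ) × C(Fin d → ℝ, Fin d → ℝ) ×
    C(Fin d → ℝ, Fin 1 → ℝ)

/-- The function computed by a two-iteration network with given continuous processors. -/
noncomputable def twoStepEval {d : ℕ} (N K : ℕ) (Q : ContinuousProcessors d)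
    (p : ChannelData N K) : EuclideanSpace ℝ (Fin K) :=
  WithLp.toLp 2 fun j => Q.2.2.2 (twoStepFeature Q.1 Q.2.1 Q.2.2.1 p j) 0

theorem continuous_twoStepFeature {N K d : ℕ} :
    Continuous fun x : ContinuousProcessors d × ChannelData N K =>
      twoStepFeature x.1.1 x.1.2.1 x.1.2.2.1 x.2 := by
  simp only [twoStepFeature]
  unfold ChannelNetMLP.toTx ChannelNetMLP.toRx
  fun_prop

theorem continuous_twoStepEval {N K d : ℕ} :
    Continuous fun x : ContinuousProcessors d × ChannelData N K => twoStepEval N K x.1 x.2 := by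
  have := continuous_twoStepFeature (N := N) (K := K) (d := d)
  unfold twoStepEval
  fun_prop

/-- On compact sets, a two-iteration network with continuous processors is approximated by
ChannelNet-MLPs of the same shape, since perceptrons are dense and the computed function depends
continuously on the processors. -/
theorem exists_isChannelNetMLP_near {N K d : ℕ} (σ : ℝ → ℝ) (hσ : Continuous σ)
    (hσ_poly : ¬ ∃ q : Polynomial ℝ, ∀ t, σ t = q.eval t) (Q : ContinuousProcessors d)
    {S : Set (ChannelData N K)} (hS : IsCompact S) {ε : ℝ} (hε : 0 < ε) :
    ∃ f : ChannelData N K → EuclideanSpace ℝ (Fin K), IsChannelNetMLP σ f ∧ Continuous f ∧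
      ∀ p ∈ S, ‖twoStepEval N K Q p - f p‖ < ε := by
  let E : ContinuousProcessors d → C(ChannelData N K, EuclideanSpace ℝ (Fin K)) := fun Q' =>
    ⟨fun p => twoStepEval N K Q p - twoStepEval N K Q' p, by
      have := continuous_twoStepEval (N := N) (K := K) (d := d)
      fun_prop⟩
  have hE : Continuous E := by
    refine ContinuousMap.continuous_of_continuous_uncurry _ ?_
    have := continuous_twoStepEval (N := N) (K := K) (d := d)
    simp only [Function.uncurry_def, E, ContinuousMap.coe_mk]
    fun_prop
  have hopen : IsOpen (E ⁻¹' {f | Set.MapsTo f S (Metric.ball 0 ε)}) :=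
    (ContinuousMap.isOpen_setOfPred_mapsTo hS Metric.isOpen_ball).preimage hE
  have hdense := (dense_isMLP 1 d σ hσ hσ_poly).prod ((dense_isMLP d d σ hσ hσ_poly).prod
    ((dense_isMLP d d σ hσ hσ_poly).prod (dense_isMLP d 1 σ hσ hσ_poly)))
  obtain ⟨Q', ⟨hIn, hψ, hφ, hOut⟩, hQ'⟩ := hdense.exists_mem_open hopen ⟨Q, fun p _ => by simp [E, hε]⟩
  let net : ChannelNetMLP σ d 1 :=
    { phiIn := Q'.1
      phi := fun _ => Q'.2.2.1
      psi := fun _ => Q'.2.1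
      psiOut := Q'.2.2.2
      phiIn_mlp := hIn
      phi_mlp := fun _ => hφ
      psi_mlp := fun _ => hψ
      psiOut_mlp := hOut }
  refine ⟨twoStepEval N K Q', ⟨d, 1, net, fun p => rfl⟩, ?_, fun p hp => ?_⟩
  · have := continuous_twoStepEval (N := N) (K := K) (d := d)
    fun_prop
  · simpa [E] using hQ' hp

/-- On a compact set of generic inputs, a maximum-likelihood detector is computed exactly by a
two-iteration network with continuous processors. -/
theorem IsMLDetector.exists_twoStepEval_eq {N K : ℕ} (hN : 0 < N) {C : Finset ℝ}
    {g : ChannelData N K → EuclideanSpace ℝ (Fin K)} (hg : IsMLDetector C g)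
    {S : Set (ChannelData N K)} (hS : IsCompact S) (hSC : ∀ p ∈ S, IsGeneric C p) :
    ∃ (d : ℕ) (Q : ContinuousProcessors d), ∀ p ∈ S, twoStepEval N K Q p = g p := by
  obtain ⟨d, φIn, ψ, φ, hsep⟩ := exists_twoStepFeature_separating N K hN
  have : CompactSpace S := isCompact_iff_compactSpace.1 hS
  have hgS : Continuous fun p : S => g p :=
    continuous_iff_continuousAt.2 fun p =>
      (hg.continuousAt (hSC p p.2)).comp continuous_subtype_val.continuousAt
  have hfeat : Continuous fun p : ChannelData N K => twoStepFeature φIn ψ φ p :=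
    (continuous_twoStepFeature (N := N) (K := K) (d := d)).comp
      (Continuous.prodMk_right ((φIn, ψ, φ, 0) : ContinuousProcessors d))
  let G : C(S × Fin K, Fin d → ℝ) := ⟨fun s => twoStepFeature φIn ψ φ s.1 s.2,
    continuous_prod_of_discrete_right.2 fun j =>
      (continuous_apply j).comp (hfeat.comp continuous_subtype_val)⟩
  let F : C(S × Fin K, ℝ) := ⟨fun s => g s.1 s.2,
    continuous_prod_of_discrete_right.2 fun j =>
      (EuclideanSpace.proj j : EuclideanSpace ℝ (Fin K) →L[ℝ] ℝ).continuous.comp hgS⟩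
  obtain ⟨c, hc⟩ := exists_continuousMap_comp_eq G F fun s s' h => by
    obtain ⟨π, τ, hτ, hy, hH⟩ := hsep C s.1 s'.1 (hSC _ s.1.2) (hSC _ s'.1.2) s.2 s'.2 h
    have := hg.apply_eq_of_perm (hSC _ s.1.2) hy hH s.2
    rwa [hτ] at this
  refine ⟨d, (φIn, ψ, φ, ⟨fun x _ => c x, by fun_prop⟩), fun p hp => ?_⟩
  ext j
  exact hc (⟨p, hp⟩, j)

theorem mainTheorem2 {N K : ℕ} (hN : 0 < N)
    (σ : ℝ → ℝ) (hσ : Continuous σ) (hσ_poly : ¬ ∃ q : Polynomial ℝ, ∀ t, σ t = q.eval t)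
    (C : Finset ℝ) (fML : ChannelData N K → EuclideanSpace ℝ (Fin K)) (hML : IsMLDetector C fML)
    (X : Set (ChannelData N K)) (hX : IsCompact X)
    (P : Measure (ChannelData N K)) [IsProbabilityMeasure P] (hPX : P Xᶜ = 0)
    (hP : HasContinuousDistribution P)
    (ε : ℝ) (hε : 0 < ε) (δ : ℝ) (hδ : 0 < δ) (hδ' : δ < 1) :
    ∃ f : ChannelData N K → EuclideanSpace ℝ (Fin K), IsChannelNetMLP σ f ∧
      NullMeasurableSet {p ∈ X | ‖fML p - f p‖ < ε} P ∧
      1 - δ < P.real {p ∈ X | ‖fML p - f p‖ < ε} := by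
  let U : Set (ChannelData N K) := {p | IsGeneric C p}
  have hU : IsOpen U := isOpen_isGeneric C
  have hae : ∀ᵐ p ∂P, p ∈ U := hP.ae_isGeneric hN C
  have hPU : P U = 1 := (prob_compl_eq_zero_iff hU.measurableSet).1 hae
  obtain ⟨S, hSU, hS, hPS⟩ := hU.exists_lt_isCompact (μ := P) (r := ENNReal.ofReal (1 - δ)) (by
    rw [hPU, ENNReal.ofReal_lt_one]
    linarith)
  obtain ⟨d, Q, hQ⟩ := hML.exists_twoStepEval_eq hN hS hSU
  obtain ⟨f, hf, hfc, hfS⟩ := exists_isChannelNetMLP_near σ hσ hσ_poly Q hS hε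
  refine ⟨f, hf, ?_, ?_⟩
  · refine hX.isClosed.measurableSet.nullMeasurableSet.inter ?_
    have hcont : ContinuousOn (fun p => ‖fML p - f p‖) U := fun p hp =>
      ((hML.continuousAt hp).sub hfc.continuousAt).norm.continuousWithinAt
    have hmeas : MeasurableSet (U ∩ (fun p => ‖fML p - f p‖) ⁻¹' Set.Iio ε) :=
      (hcont.isOpen_inter_preimage hU isOpen_Iio).measurableSet
    refine hmeas.nullMeasurableSet.congr ?_
    filter_upwards [hae] with p hp
    exact propext ⟨fun h => h.2, fun h => ⟨hp, h⟩⟩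
  · have hle : P S ≤ P {p ∈ X | ‖fML p - f p‖ < ε} := by
      refine measure_mono_ae ?_
      have hX' : ∀ᵐ p ∂P, p ∈ X := hPX
      filter_upwards [hX'] with p hpX hpS
      exact ⟨hpX, by rw [← hQ p hpS]; exact hfS p hpS⟩
    exact (ENNReal.ofReal_lt_iff_lt_toReal (by linarith) (measure_ne_top _ _)).1 (hPS.trans_le hle)
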